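/- Let $p$ be a prime number, let $F$ be a field, and let $G_F(p)$ be the maximal pro-$p$ quotient of the absolute Galois group $G_F=\mathrm{Gal}(F_{sep}/F)$. Let $S$ be a free pro-$p$ group on a set of (distinct) generators $\{x\}\cup\{y_i\mid i\in I\}$, where, if $I$ is infinite, the generators converge to $1$ (every neighbourhood of $1$ contains all but finitely many of them). Let $$1\longrightarrow R\longrightarrow S\stackrel{\pi}{\longrightarrow}G_F(p)\longrightarrow 1$$ be a minimal presentation of $G_F(p)$, that is, $\pi$ is a continuous surjective homomorphism whose kernel $R$ is contained in $S^p[S,S]$, the smallest closed subgroup of $S$ containing all $p$-th powers and all commutators. Let $[S,S]$ be the smallest closed subgroup of $S$ containing all commutators, and let $T$ be the closed subgroup of $S$ generated by $\{y_i\}_{i\in I}$. 1. Suppose that $F$ contains a primitive $p^m$-th root of unity for some $m\ge 2$. Then $R$ contains no element of the form $r=x^{p^l u}s$ with integers $l,u$ such that $1\le l<m$ and $\gcd(p,u)=1$, and with $s\in[S,S]T$. 2. Suppose that $F$ contains a primitive $p^n$-th root of unity for every $n\ge 1$. Then $R$ contains no element of the form $r=x^{p^l u}s$ with integers $l\ge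 1$ and $u\neq 0$, and with $s\in[S,S]T$. -/

import Mathlib

open Topology Filter
open scoped Pointwise

/-- A pro-`p` group: a profinite topological group all of whose open normal subgroups have
index a power of `p`. -/
structure IsProP (p : ℕ) (G : Type*) [Group G] [TopologicalSpace G] : Prop where
  isTopologicalGroup : IsTopologicalGroup G
  compactSpace : CompactSpace G
  totallyDisconnectedSpace : TotallyDisconnectedSpace G
  index_eq_pow : ∀ U : OpenNormalSubgroup G, ∃ n : ℕ, (U : Subgroup G).index = p ^ n

/-- `S` is a free pro-`p` group on the family `ι : X → S`. As usual for pro-`p` groups, the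
(possibly infinite) generating family converges to `1`: every neighbourhood of `1` contains all
but finitely many of its members. The universal property is stated for finite `p`-groups, of
which every pro-`p` group is a limit; every finite group is isomorphic to one in `Type`. The
uniqueness of the lifts says that the family generates `S` topologically. -/
structure IsFreeProP (p : ℕ) {X S : Type*} [Group S] [TopologicalSpace S] (ι : X → S) : Prop where
  isProP : IsProP p S
  tendsto_one : Tendsto ι cofinite (𝓝 1)
  existsUnique_lift : ∀ (Q : Type) [Group Q] [Finite Q] [TopologicalSpace Q] [DiscreteTopology Q],
    IsPGroup p Q → ∀ f : X → Q, {i | f i ≠ 1}.Finite →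
      ∃! φ : S →ₜ* Q, ∀ i, φ (ι i) = f i

/-- The kernel of the projection of a profinite group `G` onto its maximal pro-`p` quotient: the
intersection of all open normal subgroups of `p`-power index. -/
def maximalProPKernel (p : ℕ) (G : Type*) [Group G] [TopologicalSpace G] : Subgroup G :=
  ⨅ U : {U : OpenNormalSubgroup G // ∃ n : ℕ, (U : Subgroup G).index = p ^ n},
    ((U : OpenNormalSubgroup G) : Subgroup G)

instance maximalProPKernel_normal (p : ℕ) (G : Type*) [Group G] [TopologicalSpace G] :
    (maximalProPKernel p G).Normal :=
  Subgroup.normal_iInf_normal fun U => U.1.isNormal'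

/-- The maximal pro-`p` quotient of a profinite group, with the quotient topology. -/
abbrev MaximalProPQuotient (p : ℕ) (G : Type*) [Group G] [TopologicalSpace G] : Type _ :=
  G ⧸ maximalProPKernel p G

/-- `G_F(p)`: the maximal pro-`p` quotient of the absolute Galois group
`G_F = Gal(F_sep / F)` (with its Krull topology). -/
abbrev GaloisProP (p : ℕ) (F : Type*) [Field F] : Type _ :=
  MaximalProPQuotient p Gal(SeparableClosure F/F)

/-- The closed commutator subgroup `[S, S]`: the smallest closed subgroup containing all
commutators. -/
def closedCommutator (S : Type*) [Group S] [TopologicalSpace S] [IsTopologicalGroup S] :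
    Subgroup S :=
  (commutator S).topologicalClosure

/-- The closed subgroup generated by a family of elements. -/
def closedSubgroupGenerated {I S : Type*} [Group S] [TopologicalSpace S] [IsTopologicalGroup S]
    (y : I → S) : Subgroup S :=
  (Subgroup.closure (Set.range y)).topologicalClosure

/-- The closed subgroup `S^p [S, S]` (the Frattini subgroup if `S` is a pro-`p` group): the
smallest closed subgroup containing all `p`-th powers and all commutators. -/
def closedPowerCommutator (p : ℕ) (S : Type*) [Group S] [TopologicalSpace S]
    [IsTopologicalGroup S] : Subgroup S :=
  (Subgroup.closure (Set.range fun a : S => a ^ p) ⊔ commutator S).topologicalClosure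

/-- For a free pro-`p` group `S`, the sequence `1 → ker π → S → G → 1` is a minimal presentation
of `G`: `π` is onto and its kernel lies in `S^p [S, S]`. -/
structure IsMinimalPresentation (p : ℕ) {S G : Type*} [Group S] [TopologicalSpace S]
    [IsTopologicalGroup S] [Group G] [TopologicalSpace G] (π : S →ₜ* G) : Prop where
  surjective : Function.Surjective π
  ker_le : π.toMonoidHom.ker ≤ closedPowerCommutator p S

/-! By Kummer theory, if `F` contains a primitive `p ^ m`-th root of unity then, for `k < m`, every
character of `G_F(p)` of order dividing `p` is a `p ^ k`-th power: an eigenvector of it has a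
`p ^ k`-th root in the separable closure, itself an eigenvector of the required character.
Consequently every character `φ` of `S` of order dividing `p ^ m` kills `R`: the power
`φ ^ p ^ (m - 1)` has order dividing `p`, so it is inflated from `G_F(p)` because
`R ≤ S^p [S, S]`; dividing `φ` by the inflation of a `p ^ (m - 1)`-th root lowers its order to
`p ^ (m - 1)` without changing it on `R`. Applied to a character of `S` that is trivial on the
`y i` and takes `x` to an element of order `p ^ m`, this shows that `x ^ N * s ∈ R` forces
`p ^ m ∣ N`. -/

section ContinuousHoms

variable {G H M : Type*} [Group G] [TopologicalSpace G] [Group H] [TopologicalSpace H]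
  [Group M] [TopologicalSpace M]

theorem exists_comp_eq_of_ker_le_ker {f : G →ₜ* H} (hf : IsQuotientMap f) {φ : G →ₜ* M}
    (h : f.toMonoidHom.ker ≤ φ.toMonoidHom.ker) : ∃ ψ : H →ₜ* M, ψ.comp f = φ := by
  let ψ : H →* M := f.toMonoidHom.liftOfSurjective hf.surjective ⟨φ.toMonoidHom, h⟩
  have hψ : ∀ g, ψ (f g) = φ g :=
    f.toMonoidHom.liftOfRightInverse_comp_apply _ (Function.rightInverse_surjInv hf.surjective) _
  have hψc : Continuous ψ := hf.continuous_iff.mpr <| by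
    rw [show ψ ∘ f = φ from funext hψ]
    exact φ.continuous_toFun
  exact ⟨⟨ψ, hψc⟩, ContinuousMonoidHom.ext hψ⟩

theorem topologicalClosure_le_ker [IsTopologicalGroup G] [T1Space M] {φ : G →ₜ* M}
    {K : Subgroup G} (h : K ≤ φ.toMonoidHom.ker) : K.topologicalClosure ≤ φ.toMonoidHom.ker :=
  K.topologicalClosure_minimal h (isClosed_singleton.preimage φ.continuous_toFun)

theorem continuousMonoidHom_comp_left_injective {f : G →ₜ* H} (hf : Function.Surjective f) :
    Function.Injective fun ψ : H →ₜ* M => ψ.comp f := fun _ _ h =>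
  DFunLike.coe_injective <| hf.injective_comp_right <| congrArg DFunLike.coe h

theorem continuousMonoidHom_pow_comp {A : Type*} [CommGroup A] [TopologicalSpace A]
    [IsTopologicalGroup A] (χ : H →ₜ* A) (f : G →ₜ* H) (n : ℕ) :
    (χ ^ n).comp f = χ.comp f ^ n := by
  ext g
  simp only [ContinuousMonoidHom.coe_comp, Function.comp_apply, ContinuousMonoidHom.pow_apply]

end ContinuousHoms

section ClosedSubgroups

variable {p : ℕ} {G : Type*} [Group G] [TopologicalSpace G] [IsTopologicalGroup G]

theorem closedSubgroupGenerated_le_ker {I M : Type*} [Group M] [TopologicalSpace M] [T1Space M]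
    {y : I → G} {φ : G →ₜ* M} (h : ∀ i, φ (y i) = 1) :
    closedSubgroupGenerated y ≤ φ.toMonoidHom.ker :=
  topologicalClosure_le_ker <| (Subgroup.closure_le _).mpr <| Set.range_subset_iff.mpr h

theorem closedCommutator_le_ker {M : Type*} [CommGroup M] [TopologicalSpace M] [T1Space M]
    (φ : G →ₜ* M) : closedCommutator G ≤ φ.toMonoidHom.ker :=
  topologicalClosure_le_ker (Abelianization.commutator_subset_ker _)

theorem closedPowerCommutator_le_ker {M : Type*} [CommGroup M] [TopologicalSpace M] [T1Space M]
    {φ : G →ₜ* M} (h : ∀ g, φ g ^ p = 1) : closedPowerCommutator p G ≤ φ.toMonoidHom.ker := by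
  refine topologicalClosure_le_ker (sup_le ?_ (Abelianization.commutator_subset_ker _))
  refine (Subgroup.closure_le _).mpr <| Set.range_subset_iff.mpr fun g => ?_
  exact (map_pow φ g p).trans (h g)

variable (p G) in
theorem isClosed_maximalProPKernel : IsClosed (maximalProPKernel p G : Set G) := by
  rw [maximalProPKernel, Subgroup.coe_iInf]
  exact isClosed_iInter fun U => U.1.toOpenSubgroup.isClosed

theorem maximalProPKernel_le_ker [CompactSpace G] {M : Type*} [Group M] [TopologicalSpace M]
    [DiscreteTopology M] (hp : p.Prime) {φ : G →ₜ* M} (hφ : IsPGroup p φ.toMonoidHom.range) :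
    maximalProPKernel p G ≤ φ.toMonoidHom.ker := by
  have := Fact.mk hp
  have hopen : IsOpen (φ.toMonoidHom.ker : Set G) :=
    (isOpen_discrete {1}).preimage φ.continuous_toFun
  have : Finite (G ⧸ φ.toMonoidHom.ker) := Subgroup.quotient_finite_of_isOpen _ hopen
  obtain ⟨n, hn⟩ := IsPGroup.iff_card.mp
    (hφ.of_equiv (QuotientGroup.quotientKerEquivRange φ.toMonoidHom).symm)
  exact iInf_le_of_le ⟨⟨⟨φ.toMonoidHom.ker, hopen⟩, inferInstance⟩, n, hn⟩ le_rfl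

theorem MaximalProPQuotient.isQuotientMap {S : Type*} [Group S] [TopologicalSpace S]
    [CompactSpace S] {π : S →ₜ* MaximalProPQuotient p G} (hπ : Function.Surjective π) :
    IsQuotientMap π := by
  have := isClosed_maximalProPKernel p G
  exact π.continuous_toFun.isClosedMap.isQuotientMap π.continuous_toFun hπ

end ClosedSubgroups

section Kummer

variable {F L : Type*} [Field F] [Field L] [Algebra F L]

theorem exists_units_smul_eq_of_pow_eq_pow {n : ℕ} [NeZero n] {ζ : F} (hζ : IsPrimitiveRoot ζ n)
    {a b : L} (hb : b ≠ 0) (h : a ^ n = b ^ n) : ∃ z : Fˣ, a = z • b := by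
  have hζL : IsPrimitiveRoot (algebraMap F L ζ) n := hζ.map_of_injective (algebraMap F L).injective
  obtain ⟨i, -, hi⟩ := hζL.eq_pow_of_pow_eq_one (ξ := a / b)
    (by rw [div_pow, h, div_self (pow_ne_zero n hb)])
  refine ⟨(hζ.isUnit (NeZero.ne n)).unit ^ i, ?_⟩
  rw [Units.smul_def, Algebra.smul_def, ← div_eq_iff hb, ← hi]
  simp

theorem exists_ne_zero_forall_eq_smul_of_finiteDimensional [FiniteDimensional F L]
    (χ : Gal(L/F) →* Fˣ) : ∃ a : L, a ≠ 0 ∧ ∀ σ : Gal(L/F), σ a = χ σ • a := by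
  let f : Gal(L/F) → Lˣ := fun σ => Units.map (algebraMap F L) (χ σ)
  have hf : groupCohomology.IsMulCocycle₁ f := fun σ τ => Units.ext <| by
    simp [f, mul_comm]
  obtain ⟨a, ha⟩ := groupCohomology.isMulCoboundary₁_of_isMulCocycle₁_of_aut_to_units f hf
  refine ⟨a, a.ne_zero, fun σ => ?_⟩
  have hσ : σ • a = f σ * a := div_eq_iff_eq_mul.mp (ha σ)
  simpa [f, Units.smul_def, Algebra.smul_def] using congrArg Units.val hσ

variable [TopologicalSpace F] [DiscreteTopology F]

theorem exists_ne_zero_forall_eq_smul [IsGalois F L] (χ : Gal(L/F) →ₜ* Fˣ) :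
    ∃ a : L, a ≠ 0 ∧ ∀ σ : Gal(L/F), σ a = χ σ • a := by
  have hopen : IsOpen (χ.toMonoidHom.ker : Set Gal(L/F)) :=
    (isOpen_discrete {1}).preimage χ.continuous_toFun
  let K := IntermediateField.fixedField χ.toMonoidHom.ker
  have hK : K.fixingSubgroup = χ.toMonoidHom.ker :=
    InfiniteGalois.fixingSubgroup_fixedField ⟨_, Subgroup.isClosed_of_isOpen _ hopen⟩
  obtain ⟨_, _⟩ : FiniteDimensional F K ∧ IsGalois F K :=
    (InfiniteGalois.isOpen_and_normal_iff_finite_and_isGalois K).mp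
      ⟨hK ▸ hopen, hK ▸ inferInstance⟩
  let res : Gal(L/F) →* Gal(K/F) := AlgEquiv.restrictNormalHom K
  have hres : Function.Surjective res := AlgEquiv.restrictNormalHom_surjective L
  have hker : res.ker ≤ χ.toMonoidHom.ker := (K.restrictNormalHom_ker.trans hK).le
  obtain ⟨a, ha, hχa⟩ := exists_ne_zero_forall_eq_smul_of_finiteDimensional
    (res.liftOfSurjective hres ⟨χ.toMonoidHom, hker⟩)
  refine ⟨a, by simpa using ha, fun σ => ?_⟩
  have hσ : res.liftOfSurjective hres ⟨χ.toMonoidHom, hker⟩ (res σ) = χ σ :=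
    res.liftOfRightInverse_comp_apply _ (Function.rightInverse_surjInv hres) _ σ
  calc σ (a : L) = (res σ a : K) := (AlgEquiv.restrictNormal_commutes σ K a).symm
    _ = χ σ • (a : L) := by rw [hχa, hσ]; rfl

theorem exists_continuousMonoidHom_forall_eq_smul [Algebra.IsIntegral F L] {b : L} (hb : b ≠ 0)
    (h : ∀ σ : Gal(L/F), ∃ z : Fˣ, σ b = z • b) :
    ∃ ψ : Gal(L/F) →ₜ* Fˣ, ∀ σ : Gal(L/F), σ b = ψ σ • b := by
  have hinj : Function.Injective fun z : Fˣ => z • b :=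
    (smul_left_injective F hb).comp Units.val_injective
  choose ψ hψ using h
  let ψ' : Gal(L/F) →* Fˣ := .mk' ψ fun σ τ => hinj <| by
    calc ψ (σ * τ) • b = σ (ψ τ • b) := by rw [← hψ, ← hψ, AlgEquiv.mul_apply]
      _ = ψ τ • ψ σ • b := by rw [Units.smul_def, map_smul, hψ σ, ← Units.smul_def]
      _ = (ψ σ * ψ τ) • b := by rw [mul_comm, mul_smul]
  refine ⟨⟨ψ', continuous_of_continuousAt_one ψ' ?_⟩, hψ⟩
  rw [ContinuousAt, map_one, nhds_discrete Fˣ, tendsto_pure]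
  filter_upwards [(stabilizer_isOpen_of_isIntegral (K := F) b).mem_nhds (one_mem _)] with σ hσ
  exact hinj <| (hψ σ).symm.trans <| hσ.trans (one_smul Fˣ b).symm

theorem exists_pow_eq_of_pow_eq_one [IsGalois F L] [IsSepClosed L] {d k : ℕ} [NeZero d] [NeZero k]
    {ζ : F} (hζ : IsPrimitiveRoot ζ (d * k)) {χ : Gal(L/F) →ₜ* Fˣ} (hχ : χ ^ d = 1) :
    ∃ ψ : Gal(L/F) →ₜ* Fˣ, ψ ^ k = χ := by
  have hk : NeZero (k : L) := by
    have h := (hζ.map_of_injective (algebraMap F L).injective).neZero'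
    rw [Nat.cast_mul] at h
    exact ⟨right_ne_zero_of_mul h.out⟩
  obtain ⟨a, ha, hχa⟩ := exists_ne_zero_forall_eq_smul χ
  have had (σ : Gal(L/F)) : σ a ^ d = a ^ d := by
    rw [hχa, smul_pow, ← ContinuousMonoidHom.pow_apply, hχ, ContinuousMonoidHom.coe_one,
      Pi.one_apply, one_smul]
  obtain ⟨b, rfl⟩ := IsSepClosed.exists_pow_nat_eq a k
  have hb : b ≠ 0 := ne_zero_pow (NeZero.ne k) ha
  obtain ⟨ψ, hψ⟩ := exists_continuousMonoidHom_forall_eq_smul hb fun σ =>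
    exists_units_smul_eq_of_pow_eq_pow hζ hb <| by
      simpa only [mul_comm d, pow_mul, map_pow] using had σ
  refine ⟨ψ, ContinuousMonoidHom.ext fun σ => Units.ext <| smul_left_injective F ha ?_⟩
  calc (ψ ^ k) σ • b ^ k = (ψ σ • b) ^ k := by rw [ContinuousMonoidHom.pow_apply, smul_pow]
    _ = χ σ • b ^ k := by rw [← hψ, ← map_pow, hχa]

theorem GaloisProP.exists_pow_eq {p : ℕ} (hp : p.Prime) {k : ℕ} {ζ : F}
    (hζ : IsPrimitiveRoot ζ (p ^ (k + 1))) {χ : GaloisProP p F →ₜ* Fˣ} (hχ : χ ^ p = 1) :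
    ∃ ψ : GaloisProP p F →ₜ* Fˣ, ψ ^ p ^ k = χ := by
  have : NeZero p := ⟨hp.ne_zero⟩
  let q : Gal(SeparableClosure F/F) →ₜ* GaloisProP p F :=
    ⟨QuotientGroup.mk' _, QuotientGroup.continuous_mk⟩
  have hq : IsQuotientMap q := QuotientGroup.isQuotientMap_mk _
  have hχq : χ.comp q ^ p = 1 := by
    rw [← continuousMonoidHom_pow_comp, hχ]
    rfl
  obtain ⟨θ, hθ⟩ := exists_pow_eq_of_pow_eq_one (pow_succ' p k ▸ hζ) hχq
  have hθp : θ ^ p ^ (k + 1) = 1 := by rw [pow_succ, pow_mul, hθ, hχq]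
  have hker : q.toMonoidHom.ker ≤ θ.toMonoidHom.ker := by
    refine (QuotientGroup.ker_mk' _).trans_le (maximalProPKernel_le_ker hp ?_)
    rintro ⟨_, σ, rfl⟩
    exact ⟨k + 1, Subtype.ext <| (θ.pow_apply _ σ).symm.trans (DFunLike.congr_fun hθp σ)⟩
  obtain ⟨ψ, rfl⟩ := exists_comp_eq_of_ker_le_ker hq hker
  refine ⟨ψ, continuousMonoidHom_comp_left_injective hq.surjective ?_⟩
  exact (continuousMonoidHom_pow_comp ψ q _).trans hθ

end Kummer

theorem IsMinimalPresentation.ker_le_ker {p : ℕ} {S G M : Type*} [Group S] [TopologicalSpace S]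
    [IsTopologicalGroup S] [Group G] [TopologicalSpace G] [CommGroup M] [TopologicalSpace M]
    [IsTopologicalGroup M] [T1Space M] {π : S →ₜ* G} (hπ : IsMinimalPresentation p π)
    (hπq : IsQuotientMap π) {m : ℕ}
    (hroot : ∀ k < m, ∀ χ : G →ₜ* M, χ ^ p = 1 → ∃ ψ : G →ₜ* M, ψ ^ p ^ k = χ)
    {φ : S →ₜ* M} (hφ : φ ^ p ^ m = 1) : π.toMonoidHom.ker ≤ φ.toMonoidHom.ker := by
  induction m generalizing φ with
  | zero =>
    obtain rfl : φ = 1 := by simpa using hφ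
    exact fun _ _ => rfl
  | succ m ih =>
    have hφp : (φ ^ p ^ m) ^ p = 1 := by rw [← pow_mul, ← pow_succ, hφ]
    have hker : π.toMonoidHom.ker ≤ (φ ^ p ^ m).toMonoidHom.ker :=
      hπ.ker_le.trans <| closedPowerCommutator_le_ker fun s => by
        rw [← ContinuousMonoidHom.pow_apply, hφp, ContinuousMonoidHom.coe_one, Pi.one_apply]
    obtain ⟨χ, hχ⟩ := exists_comp_eq_of_ker_le_ker hπq hker
    have hχp : χ ^ p = 1 := continuousMonoidHom_comp_left_injective hπq.surjective <| by
      simp only [continuousMonoidHom_pow_comp, hχ, hφp]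
      rfl
    obtain ⟨ψ, rfl⟩ := hroot m m.lt_succ_self χ hχp
    have hquot : (φ / ψ.comp π) ^ p ^ m = 1 := by
      rw [div_pow, ← hχ, continuousMonoidHom_pow_comp, div_self']
    intro r hr
    have h : φ r / ψ (π r) = 1 := ih (fun k hk => hroot k (hk.trans m.lt_succ_self)) hquot hr
    rwa [show π r = 1 from hr, map_one, div_one] at h

theorem IsFreeProP.exists_continuousMonoidHom_zmod {p : ℕ} (hp : p.Prime) {X S : Type*} [Group S]
    [TopologicalSpace S] {ι : X → S} (h : IsFreeProP p ι) (i₀ : X) (n : ℕ) :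
    ∃ φ : S →ₜ* Multiplicative (ZMod (p ^ n)),
      φ (ι i₀) = .ofAdd 1 ∧ ∀ i ≠ i₀, φ (ι i) = 1 := by
  classical
  have := Fact.mk hp
  have : NeZero (p ^ n) := ⟨pow_ne_zero n hp.ne_zero⟩
  have hQ : IsPGroup p (Multiplicative (ZMod (p ^ n))) := .of_card (n := n) (by simp)
  obtain ⟨φ, hφ, -⟩ := h.existsUnique_lift _ hQ (Pi.mulSingle i₀ (.ofAdd 1))
    ((Set.finite_singleton i₀).subset fun i hi => by_contra fun hne => hi (by simp_all))
  exact ⟨φ, by simp [hφ], fun i hi => by simp [hφ, hi]⟩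

section MinimalPresentation

variable {p : ℕ} {F S : Type*} [Field F] [Group S] [TopologicalSpace S] [IsTopologicalGroup S]
  [CompactSpace S] {π : S →ₜ* GaloisProP p F} {m : ℕ} {ζ : F}

theorem IsMinimalPresentation.ker_le_ker_of_isPrimitiveRoot (hp : p.Prime)
    (hπ : IsMinimalPresentation p π) (hζ : IsPrimitiveRoot ζ (p ^ m))
    (φ : S →ₜ* Multiplicative (ZMod (p ^ m))) :
    π.toMonoidHom.ker ≤ φ.toMonoidHom.ker := by
  let _ : TopologicalSpace F := ⊥
  have : DiscreteTopology F := ⟨rfl⟩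
  have hm : p ^ m ≠ 0 := pow_ne_zero m hp.ne_zero
  let e := (hζ.isUnit_unit hm).zmodEquivZPowers.toMultiplicativeLeft
  let j : Multiplicative (ZMod (p ^ m)) →ₜ* Fˣ :=
    ⟨(Subgroup.subtype _).comp e.toMonoidHom, continuous_of_discreteTopology⟩
  have hj : Function.Injective j := Subtype.val_injective.comp e.injective
  have hφ : j.comp φ ^ p ^ m = 1 := by
    ext1 s
    have hs : φ s ^ p ^ m = 1 := Multiplicative.toAdd.injective (by simp)
    rw [ContinuousMonoidHom.pow_apply]
    exact (map_pow j (φ s) _).symm.trans ((congrArg j hs).trans (map_one j))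
  have hroot (k : ℕ) (hk : k < m) (χ : GaloisProP p F →ₜ* Fˣ) (hχ : χ ^ p = 1) :
      ∃ ψ : GaloisProP p F →ₜ* Fˣ, ψ ^ p ^ k = χ := by
    obtain ⟨c, hc⟩ := pow_dvd_pow p (Nat.succ_le_of_lt hk)
    exact GaloisProP.exists_pow_eq hp
      (hζ.pow (Nat.pos_of_ne_zero hm) (hc.trans (mul_comm _ _))) hχ
  intro r hr
  have hjr : j (φ r) = 1 :=
    hπ.ker_le_ker (MaximalProPQuotient.isQuotientMap hπ.surjective) hroot hφ hr
  exact hj (hjr.trans (map_one j).symm)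

theorem IsMinimalPresentation.pow_dvd_of_zpow_mul_mem_ker (hp : p.Prime)
    (hπ : IsMinimalPresentation p π) (hζ : IsPrimitiveRoot ζ (p ^ m))
    {I : Type*} {x : S} {y : I → S} {φ : S →ₜ* Multiplicative (ZMod (p ^ m))}
    (hφx : φ x = .ofAdd 1) (hφy : ∀ i, φ (y i) = 1) {N : ℤ} {s : S}
    (hs : s ∈ (closedCommutator S : Set S) * (closedSubgroupGenerated y : Set S))
    (h : x ^ N * s ∈ π.toMonoidHom.ker) : (p : ℤ) ^ m ∣ N := by
  obtain ⟨c, hc, t, ht, rfl⟩ := hs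
  have hφc : φ c = 1 := closedCommutator_le_ker φ hc
  have hφt : φ t = 1 := closedSubgroupGenerated_le_ker hφy ht
  have hφr : φ (x ^ N * (c * t)) = 1 := hπ.ker_le_ker_of_isPrimitiveRoot hp hζ φ h
  have hN : Multiplicative.ofAdd (1 : ZMod (p ^ m)) ^ N = 1 := by
    simpa only [map_mul, map_zpow, hφc, hφt, hφx, mul_one] using hφr
  rw [← ofAdd_zsmul, ofAdd_eq_one, zsmul_one, ZMod.intCast_zmod_eq_zero_iff_dvd] at hN
  exact_mod_cast hN

end MinimalPresentation

theorem not_pow_dvd_pow_mul {p : ℕ} (hp : p.Prime) {l m : ℕ} (hlm : l < m) {u : ℤ}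
    (hu : IsCoprime (p : ℤ) u) : ¬(p : ℤ) ^ m ∣ (p : ℤ) ^ l * u := by
  intro h
  have hdvd : (p : ℤ) ^ l * p ∣ (p : ℤ) ^ l * u :=
    pow_succ (p : ℤ) l ▸ (pow_dvd_pow _ hlm).trans h
  have hpu : (p : ℤ) ∣ u :=
    (mul_dvd_mul_iff_left (pow_ne_zero l (mod_cast hp.ne_zero))).mp hdvd
  exact (Nat.prime_iff_prime_int.mp hp).not_isUnit (hu.isUnit_of_dvd' dvd_rfl hpu)

theorem theorem3p4_general (p : ℕ) (hp : p.Prime) {F : Type*} [Field F]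
    {S : Type*} [Group S] [TopologicalSpace S] [IsTopologicalGroup S] [CompactSpace S]
    {I : Type*} (x : S) (y : I → S)
    (hxy : ∀ n : ℕ, ∃ φ : S →ₜ* Multiplicative (ZMod (p ^ n)),
      φ x = .ofAdd 1 ∧ ∀ i, φ (y i) = 1)
    (π : S →ₜ* GaloisProP p F) (hπ : IsMinimalPresentation p π) :
    (∀ m : ℕ, (∃ ζ : F, IsPrimitiveRoot ζ (p ^ m)) →
      ∀ (l : ℕ) (u : ℤ), l < m → IsCoprime (p : ℤ) u →
        ∀ s ∈ (closedCommutator S : Set S) * (closedSubgroupGenerated y : Set S),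
          x ^ ((p : ℤ) ^ l * u) * s ∉ π.toMonoidHom.ker) ∧
    ((∀ n : ℕ, ∃ ζ : F, IsPrimitiveRoot ζ (p ^ n)) →
      ∀ (l : ℕ) (u : ℤ), u ≠ 0 →
        ∀ s ∈ (closedCommutator S : Set S) * (closedSubgroupGenerated y : Set S),
          x ^ ((p : ℤ) ^ l * u) * s ∉ π.toMonoidHom.ker) := by
  have hdvd {m : ℕ} (hF : ∃ ζ : F, IsPrimitiveRoot ζ (p ^ m)) {N : ℤ} {s : S}
      (hs : s ∈ (closedCommutator S : Set S) * (closedSubgroupGenerated y : Set S))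
      (h : x ^ N * s ∈ π.toMonoidHom.ker) : (p : ℤ) ^ m ∣ N := by
    obtain ⟨ζ, hζ⟩ := hF
    obtain ⟨φ, hφx, hφy⟩ := hxy m
    exact hπ.pow_dvd_of_zpow_mul_mem_ker hp hζ hφx hφy hs h
  refine ⟨fun m hF l u hlm hu s hs h => not_pow_dvd_pow_mul hp hlm hu (hdvd hF hs h),
    fun hF l u hu s hs h => ?_⟩
  have hN : (p : ℤ) ^ l * u ≠ 0 := mul_ne_zero (pow_ne_zero l (mod_cast hp.ne_zero)) hu
  obtain ⟨n, hn⟩ : FiniteMultiplicity (p : ℤ) ((p : ℤ) ^ l * u) :=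
    Int.finiteMultiplicity_iff.mpr ⟨by simpa using hp.ne_one, hN⟩
  exact hn (hdvd (hF (n + 1)) hs h)

theorem theorem3p4 (p : ℕ) (hp : p.Prime) {F : Type*} [Field F]
    {S : Type*} [Group S] [TopologicalSpace S] [IsTopologicalGroup S]
    {I : Type*} (x : S) (y : I → S)
    (hfree : IsFreeProP p (fun o : Option I => o.elim x y))
    (π : S →ₜ* GaloisProP p F) (hπ : IsMinimalPresentation p π) :
    (∀ m : ℕ, 2 ≤ m → (∃ ζ : F, IsPrimitiveRoot ζ (p ^ m)) →
      ∀ (l : ℕ) (u : ℤ), 1 ≤ l → l < m → IsCoprime (p : ℤ) u →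
        ∀ s ∈ (closedCommutator S : Set S) * (closedSubgroupGenerated y : Set S),
          x ^ ((p : ℤ) ^ l * u) * s ∉ π.toMonoidHom.ker) ∧
    ((∀ n : ℕ, ∃ ζ : F, IsPrimitiveRoot ζ (p ^ n)) →
      ∀ (l : ℕ) (u : ℤ), 1 ≤ l → u ≠ 0 →
        ∀ s ∈ (closedCommutator S : Set S) * (closedSubgroupGenerated y : Set S),
          x ^ ((p : ℤ) ^ l * u) * s ∉ π.toMonoidHom.ker) := by
  have := hfree.isProP.compactSpace
  have hgen := theorem3p4_general p hp x y (fun n => by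
    obtain ⟨φ, hφx, hφy⟩ := hfree.exists_continuousMonoidHom_zmod hp none n
    exact ⟨φ, hφx, fun i => hφy (some i) nofun⟩) π hπ
  exact ⟨fun m _ hF l u _ => hgen.1 m hF l u, fun hF l u _ => hgen.2 hF l u⟩
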